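/- Let $m,n\ge 0$ and $\mathfrak g=\mathfrak{gl}(m|n)$ over $\mathbb C$, with basis $E_{ij}$, $1\le i,j\le m+n$, of parity $\bar\imath+\bar\jmath$, where $\bar\imath=0$ for $i\le m$ and $\bar\imath=1$ for $i>m$. Write $E_{ij}[r]=E_{ij}t^r$ for the basis elements of $\mathfrak g[t,t^{-1}]$, whose superbracket is $$[E_{ij}[r],E_{kl}[s]]=\delta_{kj}E_{il}[r+s]-\delta_{il}(-1)^{(\bar\imath+\bar\jmath)(\bar k+\bar l)}E_{kj}[r+s].$$ Let $\hat{\mathfrak g}_-=t^{-1}\mathfrak g[t^{-1}]$, identified as a vector space with the $\mathfrak g[t]$-module $\mathfrak g[t,t^{-1}]/\mathfrak g[t]$ (adjoint action). Let $S(\hat{\mathfrak g}_-)$ be its symmetric superalgebra (generated by the $E_{ij}[-r-1]$, $r\ge 0$, subject to $xy=(-1)^{|x||y|}yx$), on which $\mathfrak g[t]$ acts by superderivations, and let $$S(\hat{\mathfrak g}_-)^{\mathfrak g[t]}=\{P\in S(\hat{\mathfrak g}_-)\mid X P=0\text{ for all }X\in\mathfrak g[t]\}.$$ Let $\mathfrak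 h$ be the span of the $E_{ii}$ and $\hat{\mathfrak h}_-=t^{-1}\mathfrak h[t^{-1}]$, so that $S(\hat{\mathfrak h}_-)$ is the algebra of polynomials in the variables $E_{ii}[-r-1]$, $1\le i\le m+n$, $r\ge0$. Let $$\hat\varsigma: S(\hat{\mathfrak g}_-)\to S(\hat{\mathfrak h}_-)$$ be the projection modulo the ideal generated by all $E_{ij}[-r-1]$ with $i\ne j$ and $r\ge 0$; that is, the algebra homomorphism which fixes every $E_{ii}[-r-1]$ and sends every $E_{ij}[-r-1]$ with $i\neq j$ to $0$. Then the restriction of $\hat\varsigma$ to the subalgebra $S(\hat{\mathfrak g}_-)^{\mathfrak g[t]}$ is injective. -/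

import Mathlib

namespace GLSuper

/-! ### Symmetric algebras of super vector spaces -/

/-- The sign `(-1)^(ab)` attached to two parities. -/
def sgn (a b : ZMod 2) : ℂ := if a = 1 ∧ b = 1 then -1 else 1

/-- The supercommutation relations `x y = (-1)^(|x||y|) y x` between free generators `x`, `y`
indexed by `ι`, where `p x` is the parity of `x`. -/
inductive SuperRel {ι : Type} (p : ι → ZMod 2) : FreeAlgebra ℂ ι → FreeAlgebra ℂ ι → Prop
  | swap (a b : ι) : SuperRel p (FreeAlgebra.ι ℂ a * FreeAlgebra.ι ℂ b)
      (sgn (p a) (p b) • (FreeAlgebra.ι ℂ b * FreeAlgebra.ι ℂ a))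

/-- The congruence on the free algebra generated by the supercommutation relations. -/
def superCon {ι : Type} (p : ι → ZMod 2) : RingCon (FreeAlgebra ℂ ι) := ringConGen (SuperRel p)

/-- The (super)symmetric algebra `S(V)` of the complex super vector space `V = ι →₀ ℂ` whose
basis vector with index `a` is homogeneous of parity `p a`. Odd elements of `V` anticommute
(so they have square zero), and even elements of `V` are central. -/
def SuperSym {ι : Type} (p : ι → ZMod 2) : Type := (superCon p).Quotient

noncomputable instance {ι : Type} (p : ι → ZMod 2) : Ring (SuperSym p) :=
  inferInstanceAs (Ring (superCon p).Quotient)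

noncomputable instance {ι : Type} (p : ι → ZMod 2) : Algebra ℂ (SuperSym p) :=
  inferInstanceAs (Algebra ℂ (superCon p).Quotient)

/-- The quotient map from the free algebra. -/
noncomputable def ofFree {ι : Type} (p : ι → ZMod 2) : FreeAlgebra ℂ ι →ₐ[ℂ] SuperSym p :=
  RingCon.mkₐ ℂ (superCon p)

/-- The generator of `S(V)` given by the basis vector with index `a`. -/
noncomputable def gen {ι : Type} (p : ι → ZMod 2) (a : ι) : SuperSym p :=
  ofFree p (FreeAlgebra.ι ℂ a)

/-- The canonical linear map `V → S(V)`. -/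
noncomputable def lin {ι : Type} (p : ι → ZMod 2) : (ι →₀ ℂ) →ₗ[ℂ] SuperSym p :=
  Finsupp.linearCombination ℂ (gen p)

theorem gen_mul_gen {ι : Type} (p : ι → ZMod 2) (a b : ι) :
    gen p a * gen p b = sgn (p a) (p b) • (gen p b * gen p a) := by
  have h : ofFree p _ = ofFree p _ := 
    Quotient.sound (RingCon.le_ringConGen _ _ (SuperRel.swap (p := p) a b))
  simpa [gen, map_mul, map_smul] using h

/-- Images of the generators that satisfy the supercommutation relations determine an algebra map
out of `S(V)`. -/
noncomputable def superLift {ι : Type} (p : ι → ZMod 2) {A : Type} [Ring A] [Algebra ℂ A]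
    (f : ι → A) (hf : ∀ a b, f a * f b = sgn (p a) (p b) • (f b * f a)) : SuperSym p →ₐ[ℂ] A :=
  RingCon.liftₐ (superCon p) (FreeAlgebra.lift ℂ f) (by
    refine RingCon.ringConGen_le.2 ?_
    rintro _ _ ⟨a, b⟩
    simpa using hf a b)

theorem superLift_gen {ι : Type} (p : ι → ZMod 2) {A : Type} [Ring A] [Algebra ℂ A]
    (f : ι → A) (hf : ∀ a b, f a * f b = sgn (p a) (p b) • (f b * f a)) (a : ι) :
    superLift p f hf (gen p a) = f a :=
  (RingCon.liftₐ_mk (superCon p) (FreeAlgebra.lift ℂ f) _ (FreeAlgebra.ι ℂ a)).trans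
    (FreeAlgebra.lift_ι_apply f a)

theorem gen_mul_lin {ι : Type} (p : ι → ZMod 2) (e : ZMod 2) (v : ι →₀ ℂ)
    (hv : ∀ b, v b ≠ 0 → p b = e) (a : ι) :
    gen p a * lin p v = sgn (p a) e • (lin p v * gen p a) := by
  simp only [lin, Finsupp.linearCombination_apply, Finsupp.sum, Finset.mul_sum, Finset.sum_mul,
    Finset.smul_sum]
  refine Finset.sum_congr rfl fun b hb => ?_
  rw [mul_smul_comm, gen_mul_gen, hv b (by simpa using hb), smul_mul_assoc, smul_comm]

theorem sgn_comm (a b : ZMod 2) : sgn a b = sgn b a := by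
  simp [sgn, and_comm]

theorem sgn_add (a b c : ZMod 2) : sgn a (b + c) = sgn a b * sgn a c := by
  have h : ∀ x : ZMod 2, x = 0 ∨ x = 1 := by decide
  have h2 : (1 : ZMod 2) + 1 = 0 := by decide
  rcases h a with rfl | rfl <;> rcases h b with rfl | rfl <;> rcases h c with rfl | rfl <;>
    simp [sgn, h2]

theorem sgn_mul_self (a b : ZMod 2) : sgn a b * sgn a b = 1 := by
  unfold sgn; split_ifs <;> norm_num

/-- The algebra endomorphism of `S(V)` acting as `x ↦ (-1)^(d|x|) x` on homogeneous elements. -/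
noncomputable def twist {ι : Type} (p : ι → ZMod 2) (d : ZMod 2) : SuperSym p →ₐ[ℂ] SuperSym p :=
  superLift p (fun a => sgn d (p a) • gen p a) (by
    intro a b
    simp only [smul_mul_smul_comm]
    rw [gen_mul_gen p a b, smul_smul, smul_smul]
    congr 1
    ring)

/-- The algebra map `x ↦ ((twist x, D x), (0, x))` into upper triangular matrices that encodes
the superderivation `D` of parity `d` with `D a = f a` on generators. -/
noncomputable def superDerHom {ι : Type} (p : ι → ZMod 2) (d : ZMod 2) (f : ι → ι →₀ ℂ)
    (hf : ∀ a b, f a b ≠ 0 → p b = d + p a) :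
    SuperSym p →ₐ[ℂ] Matrix (Fin 2) (Fin 2) (SuperSym p) :=
  superLift p (fun a => !![sgn d (p a) • gen p a, lin p (f a); 0, gen p a]) (by
    intro a b
    ext i j
    fin_cases i <;> fin_cases j
    · simp [Matrix.mul_apply, Fin.sum_univ_two, smul_smul]
      rw [gen_mul_gen p a b, smul_smul]
      congr 1
      ring
    · simp only [Matrix.mul_apply, Fin.sum_univ_two, Matrix.smul_apply]
      simp only [Fin.zero_eta, Fin.mk_one, Matrix.cons_val', Matrix.cons_val_zero,
        Matrix.cons_val_one, Matrix.of_apply, Matrix.cons_val_fin_one, smul_mul_assoc]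
      rw [gen_mul_lin p (d + p b) (f b) (hf b) a, gen_mul_lin p (d + p a) (f a) (hf a) b,
        smul_add, smul_smul, smul_smul, smul_smul, add_comm]
      have e1 : sgn d (p a) * sgn (p a) (d + p b) = sgn (p a) (p b) := by
        rw [sgn_add, sgn_comm d, ← mul_assoc, sgn_mul_self, one_mul]
      have e2 : sgn (p a) (p b) * sgn d (p b) * sgn (p b) (d + p a) = 1 := by
        rw [mul_assoc, sgn_add, sgn_comm d, ← mul_assoc (sgn (p b) d), sgn_mul_self, one_mul,
          sgn_comm (p b), sgn_mul_self]
      rw [e1, e2, one_smul]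
    · simp [Matrix.mul_apply, Fin.sum_univ_two]
    · simpa [Matrix.mul_apply, Fin.sum_univ_two] using gen_mul_gen p a b)

/-- The superderivation of parity `d` of `S(V)` extending the linear map `V → V` of parity `d`
given on the basis by `f`; see `superDer_gen` and `superDer_mul`. -/
noncomputable def superDer {ι : Type} (p : ι → ZMod 2) (d : ZMod 2) (f : ι → ι →₀ ℂ)
    (hf : ∀ a b, f a b ≠ 0 → p b = d + p a) : SuperSym p →ₗ[ℂ] SuperSym p :=
  (Matrix.entryLinearMap ℂ (SuperSym p) 0 1).comp (superDerHom p d f hf).toLinearMap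

theorem superDer_gen {ι : Type} (p : ι → ZMod 2) (d : ZMod 2) (f : ι → ι →₀ ℂ)
    (hf : ∀ a b, f a b ≠ 0 → p b = d + p a) (a : ι) :
    superDer p d f hf (gen p a) = lin p (f a) := by
  simp [superDer, superDerHom, superLift_gen]

theorem superSym_induction {ι : Type} {p : ι → ZMod 2} {C : SuperSym p → Prop}
    (hs : ∀ c : ℂ, C (algebraMap ℂ _ c)) (hg : ∀ a, C (gen p a))
    (hm : ∀ x y, C x → C y → C (x * y)) (ha : ∀ x y, C x → C y → C (x + y)) (x : SuperSym p) :
    C x := by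
  obtain ⟨y, rfl⟩ : ∃ y, ofFree p y = x := RingCon.mkₐ_surjective (superCon p) x
  induction y using FreeAlgebra.induction with
  | grade0 c => rw [AlgHom.commutes]; exact hs c
  | grade1 a => exact hg a
  | mul a b h1 h2 => rw [map_mul]; exact hm _ _ h1 h2
  | add a b h1 h2 => rw [map_add]; exact ha _ _ h1 h2

theorem superDerHom_eq {ι : Type} (p : ι → ZMod 2) (d : ZMod 2) (f : ι → ι →₀ ℂ)
    (hf : ∀ a b, f a b ≠ 0 → p b = d + p a) (x : SuperSym p) :
    superDerHom p d f hf x = !![twist p d x, superDer p d f hf x; 0, x] := by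
  suffices h : superDerHom p d f hf x 0 0 = twist p d x ∧ superDerHom p d f hf x 1 0 = 0 ∧
      superDerHom p d f hf x 1 1 = x by
    obtain ⟨h1, h2, h3⟩ := h
    ext i j
    fin_cases i <;> fin_cases j <;> simp [h1, h2, h3, superDer]
  induction x using superSym_induction with
  | hs c => simp [AlgHom.commutes, Matrix.algebraMap_matrix_apply]
  | hg a => simp [superDerHom, twist, superLift_gen]
  | hm x y hx hy => simp [Matrix.mul_apply, Fin.sum_univ_two, hx, hy]
  | ha x y hx hy => simp [hx, hy]

/-- The super Leibniz rule `D(xy) = D(x) y + (-1)^(d|x|) x D(y)`. -/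
theorem superDer_mul {ι : Type} (p : ι → ZMod 2) (d : ZMod 2) (f : ι → ι →₀ ℂ)
    (hf : ∀ a b, f a b ≠ 0 → p b = d + p a) (x y : SuperSym p) :
    superDer p d f hf (x * y) =
      superDer p d f hf x * y + twist p d x * superDer p d f hf y := by
  have h : superDer p d f hf (x * y) = superDerHom p d f hf (x * y) 0 1 := rfl
  rw [h, map_mul, superDerHom_eq p d f hf x, superDerHom_eq p d f hf y]
  simp [Matrix.mul_apply, Fin.sum_univ_two, add_comm]

theorem superDer_algebraMap {ι : Type} (p : ι → ZMod 2) (d : ZMod 2) (f : ι → ι →₀ ℂ)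
    (hf : ∀ a b, f a b ≠ 0 → p b = d + p a) (c : ℂ) :
    superDer p d f hf (algebraMap ℂ _ c) = 0 := by
  simp [superDer, AlgHom.commutes, Matrix.algebraMap_matrix_apply]

/-! ### The loop superalgebra of `gl(m|n)` -/

/-- Row and column indices: `inl` is the even block `1, …, m`, `inr` the odd block. -/
abbrev Idx (m n : ℕ) : Type := Fin m ⊕ Fin n

/-- The parity `ī` of an index. -/
def idxParity {m n : ℕ} : Idx m n → ZMod 2 := Sum.elim (fun _ => 0) (fun _ => 1)

/-- The loop superalgebra `gl(m|n)[t, t⁻¹]`, as the vector space with basis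
`E_ij[r] = E_ij t^r`, indexed by `(i, j, r)`. -/
abbrev Loop (m n : ℕ) : Type := (Idx m n × Idx m n × ℤ) →₀ ℂ

/-- The basis element `E_ij[r]`. -/
noncomputable def E {m n : ℕ} (i j : Idx m n) (r : ℤ) : Loop m n := Finsupp.single (i, j, r) 1

/-- The superbracket of basis elements,
`[E_ij[r], E_kl[s]] = δ_kj E_il[r+s] - δ_il E_kj[r+s] (-1)^((ī+j̄)(k̄+l̄))`. -/
noncomputable def bracketE {m n : ℕ} (x y : Idx m n × Idx m n × ℤ) : Loop m n :=
  (if y.1 = x.2.1 then E x.1 y.2.1 (x.2.2 + y.2.2) else 0) -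
    (if x.1 = y.2.1 then
      sgn (idxParity x.1 + idxParity x.2.1) (idxParity y.1 + idxParity y.2.1) •
        E y.1 x.2.1 (x.2.2 + y.2.2) else 0)

/-- The subalgebra of positive currents `g[t]`, spanned by the `E_ij[r]` with `r ≥ 0`. -/
def posCurrents (m n : ℕ) : Submodule ℂ (Loop m n) :=
  Finsupp.supported ℂ ℂ {x | 0 ≤ x.2.2}

/-- Indices of the basis of `ĝ₋ = t⁻¹ g[t⁻¹]`: the triple `(i, j, r)` stands for `E_ij[-r-1]`. -/
abbrev NegIdx (m n : ℕ) : Type := Idx m n × Idx m n × ℕ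

/-- The parity `ī + j̄` of `E_ij[-r-1]`. -/
def negParity {m n : ℕ} (a : NegIdx m n) : ZMod 2 := idxParity a.1 + idxParity a.2.1

/-- The basis element of the loop algebra which `(i, j, r)` stands for. -/
def negToLoop {m n : ℕ} (a : NegIdx m n) : Idx m n × Idx m n × ℤ := (a.1, a.2.1, -(a.2.2 : ℤ) - 1)

/-- The projection `g[t, t⁻¹] → g[t, t⁻¹] / g[t] ≅ ĝ₋`: it reads off the coefficients of the
`E_ij[-r-1]` with `r ≥ 0`. -/
noncomputable def projNeg {m n : ℕ} (v : Loop m n) : NegIdx m n →₀ ℂ :=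
  v.comapDomain negToLoop (by
    rintro ⟨i, j, r⟩ - ⟨k, l, s⟩ - h
    simp only [negToLoop, Prod.mk.injEq] at h
    obtain ⟨h1, h2, h3⟩ := h
    have h4 : r = s := by omega
    rw [h1, h2, h4])

theorem E_apply_ne {m n : ℕ} {i j : Idx m n} {r : ℤ} {z : Idx m n × Idx m n × ℤ}
    (h : E i j r z ≠ 0) : z = (i, j, r) := by
  by_contra hz
  exact h (Finsupp.single_eq_of_ne hz)

theorem bracketE_parity {m n : ℕ} (x y z : Idx m n × Idx m n × ℤ) (h : bracketE x y z ≠ 0) :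
    idxParity z.1 + idxParity z.2.1 =
      (idxParity x.1 + idxParity x.2.1) + (idxParity y.1 + idxParity y.2.1) := by
  have two : ∀ a : ZMod 2, a + a = 0 := by decide
  have key : (y.1 = x.2.1 ∧ z = (x.1, y.2.1, x.2.2 + y.2.2)) ∨
      (x.1 = y.2.1 ∧ z = (y.1, x.2.1, x.2.2 + y.2.2)) := by
    by_contra hc
    push Not at hc
    apply h
    unfold bracketE
    have h1 : (if y.1 = x.2.1 then E x.1 y.2.1 (x.2.2 + y.2.2) else 0) z = 0 := by
      split_ifs with hi
      · by_contra h0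
        exact hc.1 hi (E_apply_ne h0)
      · rfl
    have h2 : (if x.1 = y.2.1 then
        sgn (idxParity x.1 + idxParity x.2.1) (idxParity y.1 + idxParity y.2.1) •
        E y.1 x.2.1 (x.2.2 + y.2.2) else 0) z = 0 := by
      split_ifs with hi
      · rw [Finsupp.smul_apply]
        by_contra h0
        exact hc.2 hi (E_apply_ne (right_ne_zero_of_smul h0))
      · rfl
    rw [Finsupp.sub_apply, h1, h2, sub_zero]
  rcases key with ⟨h1, rfl⟩ | ⟨h1, rfl⟩
  · simp only [h1]
    linear_combination -two (idxParity x.2.1)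
  · simp only [h1]
    linear_combination -two (idxParity y.2.1)

/-! ### Invariants and the Chevalley projection -/

/-- The symmetric algebra `S(ĝ₋)`. -/
abbrev SymNeg (m n : ℕ) : Type := SuperSym (negParity (m := m) (n := n))

theorem projNeg_bracketE_parity {m n : ℕ} (x : Idx m n × Idx m n × ℤ) (a b : NegIdx m n)
    (h : projNeg (bracketE x (negToLoop a)) b ≠ 0) :
    negParity b = idxParity x.1 + idxParity x.2.1 + negParity a :=
  bracketE_parity x (negToLoop a) (negToLoop b) h

/-- The operator on `S(ĝ₋)` given by the basis element `x = E_ij[s]`: the superderivation of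
parity `ī + j̄` that extends the adjoint action `v ↦ [x, v] mod g[t]` on `ĝ₋ ≅ g[t, t⁻¹] / g[t]`
(this is a module action for `s ≥ 0`, the only case that is used). -/
noncomputable def actE {m n : ℕ} (x : Idx m n × Idx m n × ℤ) : SymNeg m n →ₗ[ℂ] SymNeg m n :=
  superDer negParity (idxParity x.1 + idxParity x.2.1)
    (fun a => projNeg (bracketE x (negToLoop a)))
    (projNeg_bracketE_parity x)

/-- The action on `S(ĝ₋)` of an arbitrary element `X`, linear in `X`. -/
noncomputable def act {m n : ℕ} : Loop m n →ₗ[ℂ] (SymNeg m n →ₗ[ℂ] SymNeg m n) :=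
  Finsupp.linearCombination ℂ actE

/-- The subalgebra of invariants `S(ĝ₋)^{g[t]} = {P | g[t] P = 0}`. -/
noncomputable def invariants (m n : ℕ) : Subalgebra ℂ (SymNeg m n) where
  carrier := {P | ∀ X ∈ posCurrents m n, act X P = 0}
  add_mem' := fun {P Q} hP hQ X hX => by rw [map_add, hP X hX, hQ X hX, add_zero]
  algebraMap_mem' := fun c X _ => by
    simp [act, Finsupp.linearCombination_apply, Finsupp.sum, actE, superDer_algebraMap]
  mul_mem' := fun {P Q} hP hQ X hX => by
    have key : ∀ R : SymNeg m n, (∀ X ∈ posCurrents m n, act X R = 0) →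
        ∀ x : Idx m n × Idx m n × ℤ, 0 ≤ x.2.2 → actE x R = 0 := by
      intro R hR x hx
      have h := hR (Finsupp.single x 1) (Finsupp.single_mem_supported ℂ 1 hx)
      simpa [act] using h
    simp only [act, Finsupp.linearCombination_apply, Finsupp.sum, LinearMap.sum_apply,
      LinearMap.smul_apply]
    refine Finset.sum_eq_zero fun x hx => ?_
    have hx0 : 0 ≤ x.2.2 := hX hx
    have h1 := key P hP x hx0
    have h2 := key Q hQ x hx0
    unfold actE at h1 h2 ⊢
    rw [superDer_mul, h1, h2, zero_mul, mul_zero, add_zero, smul_zero]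

/-- The affine Chevalley homomorphism `S(ĝ₋) → S(ĥ₋)`, where `S(ĥ₋)` is the polynomial algebra
in the variables `E_ii[-r-1]`, indexed by `(i, r)` (for `i = inl k` this is `u_kr`, for `i = inr k`
it is `v_kr`). It is the projection modulo the ideal generated by the `E_ij[-r-1]`, `i ≠ j`: it
fixes `E_ii[-r-1]` and kills `E_ij[-r-1]` for `i ≠ j`. -/
noncomputable def affineChevalley (m n : ℕ) : SymNeg m n →ₐ[ℂ] MvPolynomial (Idx m n × ℕ) ℂ :=
  superLift negParity
    (fun a => if a.1 = a.2.1 then MvPolynomial.X (a.1, a.2.2) else 0) (by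
      have two : ∀ a : ZMod 2, a + a = 0 := by decide
      rintro ⟨i, j, r⟩ ⟨k, l, s⟩
      by_cases h1 : i = j <;> by_cases h2 : k = l
      · subst h1 h2
        simp [negParity, two, sgn, mul_comm]
      all_goals simp [h1, h2])

end GLSuper

/-!
The algebra `S(ĝ₋)` is graded by the number of off-diagonal factors `E_ij[-r-1]`, `i ≠ j`, of a
monomial, and the kernel of the affine Chevalley homomorphism consists of the elements whose
components of degree `0` vanish (`sub_diagInclusion_mem_monSpan`). It is shown that an invariant
`P` in the kernel has no component of least degree `k ≥ 1`.

For `i ≠ j` and `s ≥ 0`, the bracket with `E_ij[s]` takes `E_ji[-r-1]` to a diagonal vector and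
every other basis vector to a vector of at least the same degree. Hence the action of `E_ij[s]` is
the sum of a superderivation of degree `-1`, supported on the variables `E_ji[-r-1]`, and a
superderivation that does not lower degrees. The component `Q` of degree `k` of `P` is therefore
annihilated by the part of degree `-1`, which is the operator
`∑_{r ≥ s} (E_ii[s-r-1] ± E_jj[s-r-1]) ∂/∂E_ji[-r-1]`.
Only finitely many variables occur in `Q`. Descending induction on `s` leaves only the term
`r = s`, whose coefficient `E_ii[-1] ± E_jj[-1]` is not a zero divisor
(`eq_zero_of_gen_add_smul_gen_mul`), so all partial superderivatives of `Q` with respect to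
off-diagonal variables vanish (`partialDer_eq_zero_of_lowerDer_eq_zero`). Euler's formula
`k Q = ∑ x ∂Q/∂x` then gives `Q = 0`.

No basis of `S(ĝ₋)` is constructed. The independence of the components of different degrees
(`disjoint_monSpan`) comes from the independence of the eigenspaces of the Euler derivation, and
the fact about zero divisors from the homomorphism `S(V) → S(V)[X]` that shifts an even
generator by `X`.
-/

namespace GLSuper

open Polynomial

variable {ι : Type} {p : ι → ZMod 2}

/-! ### Signs and homogeneous vectors -/

theorem twist_gen (d : ZMod 2) (a : ι) : twist p d (gen p a) = sgn d (p a) • gen p a := by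
  simp [twist, superLift_gen]

theorem twist_add_twist (d e : ZMod 2) (x : SuperSym p) :
    twist p (d + e) (twist p e x) = twist p d x := by
  suffices h : (twist p (d + e)).comp (twist p e) = twist p d from DFunLike.congr_fun h x
  ext x
  induction x using superSym_induction with
  | hs c => simp only [AlgHom.commutes]
  | hg a =>
    simp only [AlgHom.comp_apply, twist_gen, map_smul, smul_smul]
    rw [sgn_comm (d + e), sgn_add, sgn_comm e, sgn_comm d, mul_left_comm, sgn_mul_self, mul_one]
  | hm x y hx hy => rw [map_mul, map_mul, hx, hy]
  | ha x y hx hy => rw [map_add, map_add, hx, hy]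

theorem twist_zero (x : SuperSym p) : twist p 0 x = x := by
  induction x using superSym_induction with
  | hs c => rw [AlgHom.commutes]
  | hg a => simp [twist_gen, sgn]
  | hm x y hx hy => rw [map_mul, hx, hy]
  | ha x y hx hy => rw [map_add, hx, hy]

theorem lin_mul (e : ZMod 2) (v : ι →₀ ℂ) (hv : ∀ b, v b ≠ 0 → p b = e) (x : SuperSym p) :
    lin p v * x = twist p e x * lin p v := by
  induction x using superSym_induction with
  | hs c => rw [AlgHom.commutes, Algebra.commutes]
  | hg a =>
    rw [twist_gen, smul_mul_assoc, gen_mul_lin p e v hv, smul_smul, sgn_comm e, sgn_mul_self,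
      one_smul]
  | hm x y hx hy => rw [map_mul, ← mul_assoc, hx, mul_assoc, hy, mul_assoc]
  | ha x y hx hy => rw [map_add, mul_add, add_mul, hx, hy]

theorem lin_single (a : ι) (c : ℂ) : lin p (Finsupp.single a c) = c • gen p a := by
  simp [lin]

theorem gen_mem_center {a : ι} (ha : p a = 0) : gen p a ∈ Subalgebra.center ℂ (SuperSym p) := by
  rw [Subalgebra.mem_center_iff]
  intro x
  have h := lin_mul (p := p) 0 (Finsupp.single a 1) (by
    intro b hb
    rw [Finsupp.single_apply_ne_zero] at hb
    rw [hb.1, ha]) x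
  rw [lin_single, one_smul, twist_zero] at h
  exact h.symm

/-! ### Partial superderivatives -/

open Classical in
/-- The algebra map `x ↦ ((twist x, ∂ x), (0, x))` that encodes the partial superderivative `∂`
with respect to the generator of index `a`. -/
noncomputable def partialHom (p : ι → ZMod 2) (a : ι) :
    SuperSym p →ₐ[ℂ] Matrix (Fin 2) (Fin 2) (SuperSym p) :=
  superLift p (fun b => !![sgn (p a) (p b) • gen p b, if b = a then 1 else 0; 0, gen p b]) (by
    intro b c
    ext i j
    fin_cases i <;> fin_cases j
    · simp [Matrix.mul_apply, Fin.sum_univ_two, smul_smul, gen_mul_gen p b c, -Matrix.cons_mul]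
      congr 1
      ring
    · by_cases hb : b = a <;> by_cases hc : c = a
      · subst hb hc
        simp [Matrix.mul_apply, Fin.sum_univ_two, smul_smul, sgn_mul_self, add_comm]
      · subst hb
        simp [Matrix.mul_apply, Fin.sum_univ_two, smul_smul, sgn_mul_self, hc]
      · subst hc
        simp [Matrix.mul_apply, Fin.sum_univ_two, hb, sgn_comm]
      · simp [Matrix.mul_apply, Fin.sum_univ_two, hb, hc]
    · simp [Matrix.mul_apply, Fin.sum_univ_two]
    · simpa [Matrix.mul_apply, Fin.sum_univ_two] using gen_mul_gen p b c)

/-- The partial superderivative with respect to the generator of index `a`, acting from the left: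
the superderivation of the parity of `a` that takes `gen a` to `1` and the other generators
to `0`. -/
noncomputable def partialDer (p : ι → ZMod 2) (a : ι) : SuperSym p →ₗ[ℂ] SuperSym p :=
  (Matrix.entryLinearMap ℂ (SuperSym p) 0 1).comp (partialHom p a).toLinearMap

theorem partialDer_gen_self (a : ι) : partialDer p a (gen p a) = 1 := by
  simp [partialDer, partialHom, superLift_gen]

theorem partialDer_gen_of_ne {a b : ι} (h : b ≠ a) : partialDer p a (gen p b) = 0 := by
  simp [partialDer, partialHom, superLift_gen, h]

theorem partialDer_algebraMap (a : ι) (c : ℂ) : partialDer p a (algebraMap ℂ _ c) = 0 := by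
  simp [partialDer, AlgHom.commutes, Matrix.algebraMap_matrix_apply]

theorem partialHom_eq (a : ι) (x : SuperSym p) :
    partialHom p a x = !![twist p (p a) x, partialDer p a x; 0, x] := by
  suffices h : partialHom p a x 0 0 = twist p (p a) x ∧ partialHom p a x 1 0 = 0 ∧
      partialHom p a x 1 1 = x by
    obtain ⟨h1, h2, h3⟩ := h
    ext i j
    fin_cases i <;> fin_cases j <;> simp [h1, h2, h3, partialDer]
  induction x using superSym_induction with
  | hs c => simp [AlgHom.commutes, Matrix.algebraMap_matrix_apply]
  | hg b => simp [partialHom, twist, superLift_gen]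
  | hm x y hx hy => simp [Matrix.mul_apply, Fin.sum_univ_two, hx, hy]
  | ha x y hx hy => simp [hx, hy]

theorem partialDer_mul (a : ι) (x y : SuperSym p) :
    partialDer p a (x * y) = partialDer p a x * y + twist p (p a) x * partialDer p a y := by
  have h : partialDer p a (x * y) = partialHom p a (x * y) 0 1 := rfl
  rw [h, map_mul, partialHom_eq a x, partialHom_eq a y]
  simp [Matrix.mul_apply, Fin.sum_univ_two, add_comm]

/-- Every element involves only finitely many generators. With a finite set of indices that is
large enough, a superderivation is expressed by the partial superderivatives (the chain rule), and
the partial superderivatives outside this set vanish. -/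
theorem exists_finset_superDer_eq_sum (x : SuperSym p) : ∃ F : Finset ι,
    (∀ a ∉ F, partialDer p a x = 0) ∧
    ∀ (d : ZMod 2) (f : ι → ι →₀ ℂ) (hf : ∀ a b, f a b ≠ 0 → p b = d + p a),
      superDer p d f hf x = ∑ a ∈ F, lin p (f a) * partialDer p a x := by
  classical
  have enlarge : ∀ {x : SuperSym p} {F G : Finset ι}, F ⊆ G → (∀ a ∉ F, partialDer p a x = 0) →
      ∀ f : ι → ι →₀ ℂ, ∑ a ∈ F, lin p (f a) * partialDer p a x =
        ∑ a ∈ G, lin p (f a) * partialDer p a x := fun hFG h0 f =>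
    Finset.sum_subset hFG fun a _ ha => by rw [h0 a ha, mul_zero]
  induction x using superSym_induction with
  | hs c => exact ⟨∅, by simp [partialDer_algebraMap], by simp [superDer_algebraMap]⟩
  | hg a =>
    refine ⟨{a}, fun b hb => partialDer_gen_of_ne (by simpa [eq_comm] using hb), ?_⟩
    simp [superDer_gen, partialDer_gen_self]
  | hm x y hx hy =>
    obtain ⟨F, hF0, hF⟩ := hx
    obtain ⟨G, hG0, hG⟩ := hy
    refine ⟨F ∪ G, fun a ha => ?_, fun d f hf => ?_⟩
    · rw [Finset.mem_union, not_or] at ha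
      rw [partialDer_mul, hF0 a ha.1, hG0 a ha.2, zero_mul, mul_zero, add_zero]
    · rw [superDer_mul, hF, hG, enlarge Finset.subset_union_left hF0,
        enlarge Finset.subset_union_right hG0, Finset.sum_mul, Finset.mul_sum,
        ← Finset.sum_add_distrib]
      refine Finset.sum_congr rfl fun a _ => ?_
      rw [partialDer_mul, mul_add, ← mul_assoc, ← mul_assoc, ← mul_assoc,
        lin_mul (d + p a) (f a) (hf a) (twist p (p a) x), twist_add_twist]
  | ha x y hx hy =>
    obtain ⟨F, hF0, hF⟩ := hx
    obtain ⟨G, hG0, hG⟩ := hy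
    refine ⟨F ∪ G, fun a ha => ?_, fun d f hf => ?_⟩
    · rw [Finset.mem_union, not_or] at ha
      rw [map_add, hF0 a ha.1, hG0 a ha.2, add_zero]
    · rw [map_add, hF, hG, enlarge Finset.subset_union_left hF0,
        enlarge Finset.subset_union_right hG0, ← Finset.sum_add_distrib]
      simp only [map_add, mul_add]

theorem superDer_eq_add {d : ZMod 2} {f g h : ι → ι →₀ ℂ} (hf : ∀ a b, f a b ≠ 0 → p b = d + p a)
    (hg : ∀ a b, g a b ≠ 0 → p b = d + p a) (hh : ∀ a b, h a b ≠ 0 → p b = d + p a)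
    (hfgh : ∀ a, f a = g a + h a) (x : SuperSym p) :
    superDer p d f hf x = superDer p d g hg x + superDer p d h hh x := by
  obtain ⟨F, -, hF⟩ := exists_finset_superDer_eq_sum x
  rw [hF, hF, hF, ← Finset.sum_add_distrib]
  simp only [hfgh, map_add, add_mul]

/-! ### Even linear forms that are not zero divisors -/

open Classical in
/-- The algebra map that shifts the even generator of index `a` by a new central variable. -/
noncomputable def shift (p : ι → ZMod 2) (a : ι) (ha : p a = 0) :
    SuperSym p →ₐ[ℂ] (SuperSym p)[X] :=
  superLift p (fun b => C (gen p b) + if b = a then X else 0) (by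
    intro b c
    have h : C (gen p b) * C (gen p c) = sgn (p b) (p c) • (C (gen p c) * C (gen p b)) := by
      rw [← C_mul, gen_mul_gen, ← C_mul, smul_C]
    have hs0 : ∀ e, sgn e 0 = 1 := fun e => by simp [sgn]
    have hs1 : ∀ e, sgn 0 e = 1 := fun e => by simp [sgn]
    by_cases hb : b = a <;> by_cases hc : c = a
    · rw [hb, hc, ha, hs0, one_smul]
    · subst hb
      simp only [ha, hs1, one_smul] at h
      simp [ha, hs1, hc, add_mul, mul_add, h, X_mul_C]
    · subst hc
      simp only [ha, hs0, one_smul] at h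
      simp [ha, hs0, hb, add_mul, mul_add, h, X_mul_C]
    · simpa [hb, hc] using h)

theorem constantCoeff_shift {a : ι} (ha : p a = 0) (x : SuperSym p) :
    constantCoeff (shift p a ha x) = x := by
  induction x using superSym_induction with
  | hs c =>
    rw [AlgHom.commutes]
    simp [Polynomial.algebraMap_apply]
  | hg b =>
    rw [shift, superLift_gen]
    split_ifs <;> simp
  | hm x y hx hy => rw [map_mul, map_mul, hx, hy]
  | ha x y hx hy => rw [map_add, map_add, hx, hy]

/-- The proof is valid without a basis of `S(V)`, because a monic polynomial is not a zero divisor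
even over a noncommutative ring. -/
theorem eq_zero_of_gen_add_smul_gen_mul {a b : ι} (ha : p a = 0) (hab : b ≠ a) (c : ℂ)
    {x : SuperSym p} (h : (gen p a + c • gen p b) * x = 0) : x = 0 := by
  -- After the shift of `gen a` by `X`, the factor becomes a monic polynomial.
  have h1 : (X + C (gen p a + c • gen p b)) * shift p a ha x = 0 := by
    have h2 := congrArg (shift p a ha) h
    rw [map_mul, map_zero, map_add, map_smul] at h2
    simp only [shift, superLift_gen, if_true, hab, if_false, add_zero, smul_C] at h2
    rw [C_add, ← add_assoc, add_comm X]
    exact h2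
  rw [(monic_X_add_C _).mul_right_eq_zero_iff] at h1
  rw [← constantCoeff_shift ha x, h1, map_zero]

/-! ### Weights of monomials -/

open Pointwise

/-- The span of the monomials whose weight belongs to `S`, where the weight of a monomial is the
sum of the weights `w a` of its factors `gen a`. -/
noncomputable def monSpan (p : ι → ZMod 2) (w : ι → ℤ) (S : Set ℤ) : Submodule ℂ (SuperSym p) :=
  Submodule.span ℂ ((fun l : List ι => (l.map (gen p)).prod) '' {l | (l.map w).sum ∈ S})

variable {w : ι → ℤ}

theorem monSpan_mono {S T : Set ℤ} (h : S ⊆ T) : monSpan p w S ≤ monSpan p w T :=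
  Submodule.span_mono (Set.image_mono fun _ hl => h hl)

theorem monomial_mem_monSpan {S : Set ℤ} {l : List ι} (h : (l.map w).sum ∈ S) :
    (l.map (gen p)).prod ∈ monSpan p w S :=
  Submodule.subset_span ⟨l, h, rfl⟩

theorem gen_mem_monSpan {S : Set ℤ} {a : ι} (h : w a ∈ S) : gen p a ∈ monSpan p w S := by
  simpa using monomial_mem_monSpan (p := p) (w := w) (l := [a]) (by simpa using h)

theorem lin_mem_monSpan {S : Set ℤ} {v : ι →₀ ℂ} (h : ∀ a, v a ≠ 0 → w a ∈ S) :
    lin p v ∈ monSpan p w S :=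
  Submodule.sum_mem _ fun a ha =>
    Submodule.smul_mem _ _ (gen_mem_monSpan (h a (by simpa using ha)))

theorem mul_mem_monSpan {S T U : Set ℤ} (h : S + T ⊆ U) {x y : SuperSym p}
    (hx : x ∈ monSpan p w S) (hy : y ∈ monSpan p w T) : x * y ∈ monSpan p w U := by
  have hxy : x * y ∈ monSpan p w S * monSpan p w T := Submodule.mul_mem_mul hx hy
  rw [monSpan, monSpan, Submodule.span_mul_span] at hxy
  refine Submodule.span_le.2 ?_ hxy
  rintro _ ⟨_, ⟨l, hl, rfl⟩, _, ⟨k, hk, rfl⟩, rfl⟩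
  have := monomial_mem_monSpan (p := p) (w := w) (l := l ++ k) (S := U) (by
    rw [List.map_append, List.sum_append]
    exact h (Set.add_mem_add hl hk))
  simpa using this

theorem monSpan_union (S T : Set ℤ) : monSpan p w (S ∪ T) = monSpan p w S ⊔ monSpan p w T := by
  rw [monSpan, monSpan, monSpan, ← Submodule.span_union, ← Set.image_union]
  rfl

theorem mem_monSpan_Ici_zero (hw : ∀ a, 0 ≤ w a) (x : SuperSym p) :
    x ∈ monSpan p w (Set.Ici 0) := by
  induction x using superSym_induction with
  | hs c =>
    rw [Algebra.algebraMap_eq_smul_one]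
    exact Submodule.smul_mem _ _ (monomial_mem_monSpan (l := []) (by simp))
  | hg a => exact gen_mem_monSpan (hw a)
  | hm x y hx hy =>
    refine mul_mem_monSpan ?_ hx hy
    rintro _ ⟨i, hi, j, hj, rfl⟩
    exact add_nonneg (Set.mem_Ici.1 hi) (Set.mem_Ici.1 hj)
  | ha x y hx hy => exact Submodule.add_mem _ hx hy

theorem exists_mem_monSpan_Iio (x : SuperSym p) : ∃ k : ℕ, x ∈ monSpan p w (Set.Iio (k : ℤ)) := by
  induction x using superSym_induction with
  | hs c =>
    refine ⟨1, ?_⟩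
    rw [Algebra.algebraMap_eq_smul_one]
    exact Submodule.smul_mem _ _ (monomial_mem_monSpan (l := []) (by simp))
  | hg a => exact ⟨(w a).toNat + 1, gen_mem_monSpan (by simp)⟩
  | hm x y hx hy =>
    obtain ⟨k, hk⟩ := hx
    obtain ⟨l, hl⟩ := hy
    refine ⟨k + l, mul_mem_monSpan ?_ hk hl⟩
    rintro _ ⟨i, hi, j, hj, rfl⟩
    simp only [Set.mem_Iio, Nat.cast_add] at *
    omega
  | ha x y hx hy =>
    obtain ⟨k, hk⟩ := hx
    obtain ⟨l, hl⟩ := hy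
    refine ⟨k + l, Submodule.add_mem _ (monSpan_mono ?_ hk) (monSpan_mono ?_ hl)⟩ <;>
      exact Set.Iio_subset_Iio (by simp)

/-- A superderivation that moves the weights of the generators by elements of `T` moves all weights
by elements of `T`. -/
theorem superDer_mem_monSpan {S T U : Set ℤ} (h : S + T ⊆ U) {d : ZMod 2} {f : ι → ι →₀ ℂ}
    (hf : ∀ a b, f a b ≠ 0 → p b = d + p a) (hw : ∀ a b, f a b ≠ 0 → w b - w a ∈ T)
    {x : SuperSym p} (hx : x ∈ monSpan p w S) : superDer p d f hf x ∈ monSpan p w U := by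
  have key : ∀ l : List ι,
      superDer p d f hf (l.map (gen p)).prod ∈ monSpan p w ({(l.map w).sum} + T) := by
    intro l
    induction l with
    | nil =>
      have h1 := superDer_algebraMap p d f hf 1
      rw [map_one] at h1
      simp [h1]
    | cons a l ih =>
      rw [List.map_cons, List.map_cons, List.prod_cons, superDer_mul, superDer_gen, twist_gen,
        List.sum_cons]
      refine Submodule.add_mem _ ?_ ?_
      · refine mul_mem_monSpan (S := {w a} + T) (T := {(l.map w).sum}) ?_
          (lin_mem_monSpan fun b hb => ⟨w a, rfl, _, hw a b hb, by simp⟩)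
          (monomial_mem_monSpan rfl)
        rw [add_right_comm, Set.singleton_add_singleton]
      · refine mul_mem_monSpan (S := {w a}) ?_
          (Submodule.smul_mem _ _ (gen_mem_monSpan rfl)) ih
        rw [← add_assoc, Set.singleton_add_singleton]
  suffices monSpan p w S ≤ (monSpan p w U).comap (superDer p d f hf) from this hx
  refine Submodule.span_le.2 ?_
  rintro _ ⟨l, hl, rfl⟩
  refine monSpan_mono (subset_trans (Set.add_subset_add_right ?_) h) (key l)
  simpa using hl

/-- The Euler derivation, which multiplies a monomial by its weight. -/
noncomputable def euler (p : ι → ZMod 2) (w : ι → ℤ) : SuperSym p →ₗ[ℂ] SuperSym p :=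
  superDer p 0 (fun a => Finsupp.single a (w a : ℂ)) (by
    intro a b h
    rw [Finsupp.single_apply_ne_zero] at h
    rw [h.1, zero_add])

theorem euler_monomial (l : List ι) :
    euler p w (l.map (gen p)).prod = ((l.map w).sum : ℂ) • (l.map (gen p)).prod := by
  induction l with
  | nil =>
    have h1 := superDer_algebraMap p 0 (fun a => Finsupp.single a (w a : ℂ)) (by
      intro a b h
      rw [Finsupp.single_apply_ne_zero] at h
      rw [h.1, zero_add]) 1
    rw [map_one] at h1
    simpa [euler] using h1
  | cons a l ih =>
    rw [euler] at ih ⊢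
    rw [List.map_cons, List.map_cons, List.prod_cons, superDer_mul, superDer_gen, twist_zero, ih,
      lin_single, List.sum_cons, smul_mul_assoc, mul_smul_comm, ← add_smul, Int.cast_add]

theorem monSpan_le_iSup_eigenspace (S : Set ℤ) :
    monSpan p w S ≤ ⨆ μ ∈ ((fun k : ℤ => (k : ℂ)) '' S), Module.End.eigenspace (euler p w) μ := by
  refine Submodule.span_le.2 ?_
  rintro _ ⟨l, hl, rfl⟩
  refine Submodule.mem_iSup_of_mem (((l.map w).sum : ℤ) : ℂ)
    (Submodule.mem_iSup_of_mem ⟨_, hl, rfl⟩ ?_)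
  rw [Module.End.mem_eigenspace_iff]
  exact euler_monomial l

theorem disjoint_monSpan {S T : Set ℤ} (h : Disjoint S T) :
    Disjoint (monSpan p w S) (monSpan p w T) := by
  refine Disjoint.mono (monSpan_le_iSup_eigenspace S) (monSpan_le_iSup_eigenspace T) ?_
  exact (Module.End.eigenspaces_iSupIndep (euler p w)).disjoint_biSup_biSup
    ((Set.disjoint_image_iff Int.cast_injective).2 h)

theorem eq_zero_of_euler_eq_zero {k : ℤ} (hk : k ≠ 0) {x : SuperSym p}
    (hx : x ∈ monSpan p w {k}) (h : euler p w x = 0) : x = 0 := by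
  have h1 := monSpan_le_iSup_eigenspace _ hx
  rw [Set.image_singleton, iSup_singleton, Module.End.mem_eigenspace_iff, h] at h1
  exact (smul_eq_zero.1 h1.symm).resolve_left (by exact_mod_cast hk)

variable {m n : ℕ}

/-! ### The kernel of the affine Chevalley homomorphism -/

/-- The weight of the generator `E_ij[-r-1]`: it is `0` if `i = j` and `1` otherwise, so that the
weight of a monomial is the number of its off-diagonal factors. -/
def offWeight (a : NegIdx m n) : ℤ := if a.1 = a.2.1 then 0 else 1

theorem offWeight_nonneg (a : NegIdx m n) : 0 ≤ offWeight a := by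
  unfold offWeight; split_ifs <;> norm_num

theorem negParity_diag (i : Idx m n) (r : ℕ) : negParity (i, i, r) = 0 :=
  CharTwo.add_self_eq_zero (idxParity i)

/-- The inclusion `S(ĥ₋) → S(ĝ₋)`, whose image is central. -/
noncomputable def diagInclusion (m n : ℕ) :
    MvPolynomial (Idx m n × ℕ) ℂ →ₐ[ℂ] Subalgebra.center ℂ (SymNeg m n) :=
  MvPolynomial.aeval fun a =>
    ⟨gen negParity (a.1, a.1, a.2), gen_mem_center (negParity_diag a.1 a.2)⟩

/-- In particular, elements of the kernel of the affine Chevalley homomorphism are combinations of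
monomials with at least one off-diagonal factor. -/
theorem sub_diagInclusion_mem_monSpan (x : SymNeg m n) :
    x - diagInclusion m n (affineChevalley m n x) ∈ monSpan negParity offWeight (Set.Ici 1) := by
  induction x using superSym_induction with
  | hs c => simp [AlgHom.commutes]
  | hg a =>
    obtain ⟨i, j, r⟩ := a
    rw [affineChevalley, superLift_gen]
    by_cases h : i = j
    · subst h
      simp [diagInclusion]
    · simpa [h] using gen_mem_monSpan (by simp [offWeight, h])
  | hm x y hx hy =>
    have e : x * y - diagInclusion m n (affineChevalley m n (x * y)) =
        (x - diagInclusion m n (affineChevalley m n x)) * y +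
        diagInclusion m n (affineChevalley m n x) *
          (y - diagInclusion m n (affineChevalley m n y)) := by
      rw [map_mul, map_mul, Subalgebra.coe_mul]
      noncomm_ring
    rw [e]
    refine Submodule.add_mem _ (mul_mem_monSpan ?_ hx (mem_monSpan_Ici_zero offWeight_nonneg _))
      (mul_mem_monSpan ?_ (mem_monSpan_Ici_zero offWeight_nonneg _) hy) <;>
    · rintro _ ⟨i, hi, j, hj, rfl⟩
      simp only [Set.mem_Ici] at *
      omega
  | ha x y hx hy =>
    convert Submodule.add_mem _ hx hy using 1
    rw [map_add, map_add, Subalgebra.coe_add]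
    abel

/-! ### The part of the action that lowers the off-diagonal degree -/

theorem bracketE_support {x y z : Idx m n × Idx m n × ℤ} (h : bracketE x y z ≠ 0) :
    (y.1 = x.2.1 ∧ z = (x.1, y.2.1, x.2.2 + y.2.2)) ∨
      (x.1 = y.2.1 ∧ z = (y.1, x.2.1, x.2.2 + y.2.2)) := by
  by_contra hc
  push Not at hc
  apply h
  have h1 : y.1 = x.2.1 → E x.1 y.2.1 (x.2.2 + y.2.2) z = 0 := fun hi => by
    by_contra h0
    exact hc.1 hi (E_apply_ne h0)
  have h2 : x.1 = y.2.1 → E y.1 x.2.1 (x.2.2 + y.2.2) z = 0 := fun hi => by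
    by_contra h0
    exact hc.2 hi (E_apply_ne h0)
  unfold bracketE
  split_ifs with ha hb hb
  · simp [h1 ha, h2 hb]
  · simp [h1 ha]
  · simp [h2 hb]
  · simp

/-- The vector of `ĝ₋` given by `[E_ij[s], E_kl[-r-1]] mod g[t]`, where `a = (k, l, r)`. -/
noncomputable def adVec (i j : Idx m n) (s : ℕ) (a : NegIdx m n) : NegIdx m n →₀ ℂ :=
  projNeg (bracketE (i, j, (s : ℤ)) (negToLoop a))

theorem adVec_support {i j : Idx m n} {s : ℕ} {a b : NegIdx m n} (h : adVec i j s a b ≠ 0) :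
    s ≤ a.2.2 ∧ ((a.1 = j ∧ b.1 = i ∧ b.2.1 = a.2.1) ∨ (i = a.2.1 ∧ b.1 = a.1 ∧ b.2.1 = j)) := by
  rcases bracketE_support (z := negToLoop b) h with ⟨h1, h2⟩ | ⟨h1, h2⟩ <;>
  · simp only [negToLoop, Prod.mk.injEq] at h1 h2
    refine ⟨by omega, ?_⟩
    tauto

/-- The linear form that is not a zero divisor arises here: `[E_ij[s], E_ji[-s-1]]` is
`E_ii[-1] ± E_jj[-1]`. -/
theorem adVec_opposite {i j : Idx m n} (s : ℕ) :
    ∃ c : ℂ, adVec i j s (j, i, s) =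
      Finsupp.single (i, i, 0) 1 + Finsupp.single (j, j, 0) c := by
  refine ⟨-sgn (idxParity i + idxParity j) (idxParity j + idxParity i), ?_⟩
  have key : ∀ (k : Idx m n) (b : NegIdx m n),
      (E k k ((s : ℤ) + (-(s : ℤ) - 1)) : Loop m n) (negToLoop b) =
        (Finsupp.single (k, k, 0) 1 : NegIdx m n →₀ ℂ) b := by
    rintro k ⟨k1, k2, r⟩
    have hr : (s : ℤ) + (-(s : ℤ) - 1) = -(r : ℤ) - 1 ↔ 0 = r := by omega
    simp only [E, negToLoop, Finsupp.single_apply, Prod.mk.injEq, hr]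
  ext b
  have h : adVec i j s (j, i, s) b =
      bracketE (i, j, (s : ℤ)) (negToLoop (j, i, s)) (negToLoop b) := rfl
  rw [h, bracketE]
  simp only [negToLoop, if_true, Finsupp.sub_apply, Finsupp.smul_apply, Finsupp.add_apply]
  have h1 := key i b
  have h2 := key j b
  simp only [negToLoop] at h1 h2
  rw [h1, h2, Finsupp.single_apply, Finsupp.single_apply, Finsupp.single_apply]
  split_ifs <;> simp [sub_eq_add_neg]

theorem adVec_parity {i j : Idx m n} {s : ℕ} (a b : NegIdx m n) (h : adVec i j s a b ≠ 0) :
    negParity b = idxParity i + idxParity j + negParity a :=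
  projNeg_bracketE_parity (i, j, (s : ℤ)) a b h

/-- The restriction of `adVec i j s` to the basis vectors `E_ji[-r-1]`. -/
noncomputable def lowerVec (i j : Idx m n) (s : ℕ) (a : NegIdx m n) : NegIdx m n →₀ ℂ :=
  if a.1 = j ∧ a.2.1 = i then adVec i j s a else 0

theorem lowerVec_parity {i j : Idx m n} {s : ℕ} (a b : NegIdx m n) (h : lowerVec i j s a b ≠ 0) :
    negParity b = idxParity i + idxParity j + negParity a := by
  unfold lowerVec at h
  split_ifs at h
  · exact adVec_parity a b h
  · exact absurd rfl h

/-- The restriction of `adVec i j s` to the basis vectors other than the `E_ji[-r-1]`. -/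
noncomputable def upperVec (i j : Idx m n) (s : ℕ) (a : NegIdx m n) : NegIdx m n →₀ ℂ :=
  if a.1 = j ∧ a.2.1 = i then 0 else adVec i j s a

theorem upperVec_parity {i j : Idx m n} {s : ℕ} (a b : NegIdx m n) (h : upperVec i j s a b ≠ 0) :
    negParity b = idxParity i + idxParity j + negParity a := by
  unfold upperVec at h
  split_ifs at h
  · exact absurd rfl h
  · exact adVec_parity a b h

/-- The superderivation of `S(ĝ₋)` that is the component of degree `-1` of the action of `E_ij[s]`,
`i ≠ j`, with respect to the number of off-diagonal factors. -/
noncomputable def lowerDer (i j : Idx m n) (s : ℕ) : SymNeg m n →ₗ[ℂ] SymNeg m n :=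
  superDer negParity (idxParity i + idxParity j) (lowerVec i j s) lowerVec_parity

/-- The superderivation of `S(ĝ₋)` that consists of the components of degrees `0` and `1` of the
action of `E_ij[s]`, `i ≠ j`, with respect to the number of off-diagonal factors. -/
noncomputable def upperDer (i j : Idx m n) (s : ℕ) : SymNeg m n →ₗ[ℂ] SymNeg m n :=
  superDer negParity (idxParity i + idxParity j) (upperVec i j s) upperVec_parity

theorem actE_eq_lowerDer_add_upperDer (i j : Idx m n) (s : ℕ) (x : SymNeg m n) :
    actE (i, j, (s : ℤ)) x = lowerDer i j s x + upperDer i j s x := by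
  refine superDer_eq_add _ _ _ (fun a => ?_) x
  simp only [lowerVec, upperVec, adVec]
  split_ifs <;> simp

theorem lowerVec_weight {i j : Idx m n} (hij : i ≠ j) {s : ℕ} {a b : NegIdx m n}
    (h : lowerVec i j s a b ≠ 0) : offWeight b - offWeight a = -1 := by
  unfold lowerVec at h
  split_ifs at h with ha
  · have hb : b.1 = b.2.1 := by
      rcases (adVec_support h).2 with ⟨h1, h2, h3⟩ | ⟨h1, h2, h3⟩
      · rw [h2, h3, ha.2]
      · rw [h2, h3, ha.1]
    simp [offWeight, hb, ha, hij.symm]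
  · exact absurd rfl h

theorem upperVec_weight {i j : Idx m n} {s : ℕ} {a b : NegIdx m n}
    (h : upperVec i j s a b ≠ 0) : 0 ≤ offWeight b - offWeight a := by
  unfold upperVec at h
  split_ifs at h with ha
  · exact absurd rfl h
  · by_cases hd : a.1 = a.2.1
    · simpa [offWeight, hd] using offWeight_nonneg b
    · have hb : b.1 ≠ b.2.1 := by
        rcases (adVec_support h).2 with ⟨h1, h2, h3⟩ | ⟨h1, h2, h3⟩
        · rw [h2, h3]
          exact fun e => ha ⟨h1, e.symm⟩
        · rw [h2, h3]
          exact fun e => ha ⟨e, h1.symm⟩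
      simp [offWeight, hb, hd]

/-! ### Elements annihilated by the lowering parts -/

/-- By descending induction on `s`: if the partial superderivatives of `x` with respect to all
`E_ji[-r-1]`, `r > s`, vanish, then `lowerDer i j s x` is the product of `E_ii[-1] ± E_jj[-1]`,
which is not a zero divisor, and the partial superderivative with respect to `E_ji[-s-1]`. -/
theorem partialDer_eq_zero_of_lowerDer_eq_zero {i j : Idx m n} (hij : i ≠ j) {x : SymNeg m n}
    (h : ∀ s, lowerDer i j s x = 0) (s : ℕ) : partialDer negParity (j, i, s) x = 0 := by
  obtain ⟨F, hF0, hF⟩ := exists_finset_superDer_eq_sum x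
  obtain ⟨N, hN⟩ : ∃ N : ℕ, ∀ a ∈ F, a.2.2 < N :=
    ⟨F.sup (fun a => a.2.2) + 1, fun a ha =>
      Nat.lt_succ_of_le (Finset.le_sup (f := fun a : NegIdx m n => a.2.2) ha)⟩
  induction hd : N - s using Nat.strong_induction_on generalizing s with
  | _ d ih =>
    by_cases hs : (j, i, s) ∈ F
    · have hlt : s < N := hN _ hs
      have h1 := h s
      rw [lowerDer, hF, Finset.sum_eq_single_of_mem _ hs] at h1
      · obtain ⟨c, hc⟩ := adVec_opposite (i := i) (j := j) s
        rw [lowerVec, if_pos ⟨rfl, rfl⟩, hc, map_add, lin_single, lin_single, one_smul] at h1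
        refine eq_zero_of_gen_add_smul_gen_mul (negParity_diag i 0) ?_ c h1
        simp [hij.symm]
      · rintro ⟨k, l, r⟩ - hne
        by_cases hkl : k = j ∧ l = i
        · obtain ⟨rfl, rfl⟩ := hkl
          rcases lt_trichotomy r s with hr | rfl | hr
          · have h0 : adVec l k s (k, l, r) = 0 := by
              ext b
              by_contra hb
              exact absurd (adVec_support hb).1 (not_le.2 hr)
            simp [lowerVec, h0]
          · exact absurd rfl hne
          · rw [ih (N - r) (by omega) r rfl, mul_zero]
        · simp [lowerVec, hkl]
    · exact hF0 _ hs

theorem eq_zero_of_lowerDer_eq_zero {k : ℤ} (hk : k ≠ 0) {x : SymNeg m n}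
    (hx : x ∈ monSpan negParity offWeight {k})
    (h : ∀ i j, i ≠ j → ∀ s, lowerDer i j s x = 0) : x = 0 := by
  refine eq_zero_of_euler_eq_zero hk hx ?_
  obtain ⟨F, -, hF⟩ := exists_finset_superDer_eq_sum x
  rw [euler, hF]
  refine Finset.sum_eq_zero ?_
  rintro ⟨i, j, r⟩ -
  by_cases hij : i = j
  · simp [offWeight, hij]
  · rw [partialDer_eq_zero_of_lowerDer_eq_zero (Ne.symm hij) (h j i (Ne.symm hij)) r, mul_zero]

theorem actE_eq_zero_of_mem_invariants {x : SymNeg m n} (hx : x ∈ invariants m n)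
    (i j : Idx m n) (s : ℕ) : actE (i, j, (s : ℤ)) x = 0 := by
  have h := hx (Finsupp.single (i, j, (s : ℤ)) 1) (Finsupp.single_mem_supported ℂ 1 (by simp))
  simpa [act] using h

/-- The component `q` of least degree of an invariant is annihilated by the lowering parts, because
nothing else contributes to degree `k - 1`. -/
theorem mem_monSpan_Ici_succ_of_mem_invariants {x : SymNeg m n} (hx : x ∈ invariants m n) {k : ℤ}
    (hk : k ≠ 0) (hxk : x ∈ monSpan negParity offWeight (Set.Ici k)) :
    x ∈ monSpan negParity offWeight (Set.Ici (k + 1)) := by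
  have hun : Set.Ici k = {k} ∪ Set.Ici (k + 1) := by
    ext z
    simp only [Set.mem_Ici, Set.singleton_union, Set.mem_insert_iff]
    omega
  have hxk' := hxk
  rw [hun, monSpan_union] at hxk'
  obtain ⟨q, hq, r, hr, rfl⟩ := Submodule.mem_sup.1 hxk'
  suffices q = 0 by rwa [this, zero_add]
  refine eq_zero_of_lowerDer_eq_zero hk hq fun i j hij s => ?_
  have h0 := actE_eq_zero_of_mem_invariants hx i j s
  rw [actE_eq_lowerDer_add_upperDer, map_add, add_assoc, add_eq_zero_iff_eq_neg] at h0
  have hq' : lowerDer i j s q ∈ monSpan negParity offWeight {k - 1} :=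
    superDer_mem_monSpan (T := {-1}) (by simp [sub_eq_add_neg]) _
      (fun a b hab => lowerVec_weight hij hab) hq
  refine Submodule.disjoint_def.1 (disjoint_monSpan (T := Set.Ici k) ?_) _ hq' ?_
  · simp
  · rw [h0]
    refine Submodule.neg_mem _ (Submodule.add_mem _ ?_ ?_)
    · refine superDer_mem_monSpan (T := {-1}) ?_ _ (fun a b hab => lowerVec_weight hij hab) hr
      rintro _ ⟨u, hu, v, rfl, rfl⟩
      simp only [Set.mem_Ici] at *
      omega
    · refine superDer_mem_monSpan (T := Set.Ici 0) ?_ _ (fun a b hab => upperVec_weight hab) hxk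
      rintro _ ⟨u, hu, v, hv, rfl⟩
      simp only [Set.mem_Ici] at *
      omega

end GLSuper

theorem proposition4p1 (m n : ℕ) :
    Function.Injective
      ((GLSuper.affineChevalley m n).comp (GLSuper.invariants m n).val) := by
  rw [injective_iff_map_eq_zero]
  rintro ⟨x, hx⟩ h
  have h0 : GLSuper.affineChevalley m n x = 0 := h
  have hmem : ∀ k : ℕ,
      x ∈ GLSuper.monSpan GLSuper.negParity GLSuper.offWeight (Set.Ici ((k : ℤ) + 1)) := by
    intro k
    induction k with
    | zero => simpa [h0] using GLSuper.sub_diagInclusion_mem_monSpan x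
    | succ k ih =>
      have := GLSuper.mem_monSpan_Ici_succ_of_mem_invariants hx (by omega) ih
      simpa using this
  obtain ⟨k, hk⟩ := GLSuper.exists_mem_monSpan_Iio (w := GLSuper.offWeight) x
  refine Subtype.ext (Submodule.disjoint_def.1 (GLSuper.disjoint_monSpan ?_) _ (hmem k) hk)
  rw [Set.disjoint_left]
  intro z hz hz'
  simp only [Set.mem_Ici, Set.mem_Iio] at hz hz'
  omega
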